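/- Let $n\ge 3$ and let $P\subset\mathbb{R}^2\times\{1\}\subset\mathbb{R}^3$ be a convex polygon with vertices (extreme points) $v_1,\dots,v_n$ in counter-clockwise order, i.e. $\langle v_i,v_j,v_k\rangle>0$ for $1\le i<j<k\le n$, where $\langle u,v,w\rangle$ is the determinant of the matrix with columns $u,v,w$; indices of vertices are read modulo $n$. (If the $v_i$ are integral, $P$ is a toric diagram; integrality is not needed.) Put $$\hat F_P(\phi)=\sum_{1\le i<j<k\le n}|\langle v_i,v_j,v_k\rangle|\,\phi^i\phi^j\phi^k\quad(\phi\in\mathbb{R}^n),$$ let $\pi_P(\phi)=\sum_i\phi^i v_i$, and for $b\in\mathbb{R}^3$ let $\pi_P^{-1}(b)=\{\phi\in\mathbb{R}^n_{\ge0}:\pi_P(\phi)=b\}$. For $b\in\mathbb{R}^3$ with nonvanishing denominators put $$\ell_P^i(b)=\frac{\langle v_{i-1},v_i,v_{i+1}\rangle}{\langle b,v_{i-1},v_i\rangle\,\langle b,v_i,v_{i+1}\rangle},\qquad V_P(b)=\sum_{i=1}^n\ell_P^i(b)$$ ($V_P$ is the Martelli--Sparks--Yau trial volume, up to a constant factor).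 Let $r>0$ and $\Gamma_n=\{\phi\in\mathbb{R}^n_{\ge0}:\sum_i\phi^i=r\}$. (i) For every $b\in rP$ there is a quadratic form $Q$ on $\mathbb{R}^n$ with $\hat F_P(\phi)=Q(\phi)$ for all $\phi\in\mathbb{R}^n$ with $\sum_i\phi^iv_i=b$; in particular the restriction of $\hat F_P$ to the fiber $\pi_P^{-1}(b)$ is a quadratic polynomial. (ii) Let $b\in\operatorname{relint}(rP)$. Then $\langle b,v_i,v_{i+1}\rangle>0$ for all $i$, and $V_P(b)>0$. The restriction of $\hat F_P$ to the affine subspace $\{\phi\in\mathbb{R}^n:\sum_i\phi^iv_i=b\}$ has exactly one critical point $\sigma_P(b)$, namely $$\sigma_P^i(b)=\frac{r}{V_P(b)}\,\ell_P^i(b)\qquad(i=1,\dots,n);$$ it lies in the fiber $\pi_P^{-1}(b)$, it is a maximum point of $\hat F_P$ on the fiber, and $$\max_{\phi\in\pi_P^{-1}(b)}\hat F_P(\phi)=\hat F_P(\sigma_P(b))=\frac{r}{V_P(b)}.$$ (iii) $V_P$ attains a minimum on $\operatorname{relint}(rP)$, and $a$-maximization is equivalent to volume minimization in the sense that $$\max_{\phi\in\Gamma_n}\hat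 F_P(\phi)=\frac{r}{\min_{b\in\operatorname{relint}(rP)}V_P(b)}.$$ -/

import Mathlib

open scoped Pointwise

noncomputable section

/-- The determinant of the real 3 by 3 matrix whose columns are `u`, `v`, `w`. -/
def det3 (u v w : Fin 3 → ℝ) : ℝ := (Matrix.of ![u, v, w]).transpose.det

/-- A convex polygon with `n ≥ 3` vertices in the plane at height one of `ℝ³`, given by its
vertices in counter-clockwise order. The strict positivity of all the determinants says that the
vertices are in strictly convex position (each of them is an extreme point of their convex hull)
and are listed counter-clockwise. A toric diagram is the case of integral vertices. -/
structure HeightOnePolygon (n : ℕ) where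
  vertex : Fin n → (Fin 3 → ℝ)
  three_le : 3 ≤ n
  height_one : ∀ i, vertex i 2 = 1
  det_pos : ∀ i j k, i < j → j < k → 0 < det3 (vertex i) (vertex j) (vertex k)

namespace HeightOnePolygon

/-- The polygon itself, as a subset of `ℝ³`. -/
def toSet {n : ℕ} (P : HeightOnePolygon n) : Set (Fin 3 → ℝ) :=
  convexHull ℝ (Set.range P.vertex)

/-- The vertex after vertex `i` in the cyclic order. -/
def next {n : ℕ} (P : HeightOnePolygon n) (i : Fin n) : Fin 3 → ℝ :=
  P.vertex (finRotate n i)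

/-- The vertex before vertex `i` in the cyclic order. -/
def prev {n : ℕ} (P : HeightOnePolygon n) (i : Fin n) : Fin 3 → ℝ :=
  P.vertex ((finRotate n).symm i)

/-- The cubic form `∑_{i<j<k} |det(vᵢ, vⱼ, vₖ)| φⁱ φʲ φᵏ` on `ℝⁿ`. -/
def cubic {n : ℕ} (P : HeightOnePolygon n) (φ : Fin n → ℝ) : ℝ :=
  ∑ i : Fin n, ∑ j ∈ Finset.Ioi i, ∑ k ∈ Finset.Ioi j,
    |det3 (P.vertex i) (P.vertex j) (P.vertex k)| * φ i * φ j * φ k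

/-- The linear map `φ ↦ ∑ φⁱ vᵢ` from `ℝⁿ` to `ℝ³`. -/
def proj {n : ℕ} (P : HeightOnePolygon n) (φ : Fin n → ℝ) : Fin 3 → ℝ :=
  ∑ i : Fin n, φ i • P.vertex i

/-- The fiber over `b` of the restriction of `proj` to the nonnegative orthant. -/
def fiber {n : ℕ} (P : HeightOnePolygon n) (b : Fin 3 → ℝ) : Set (Fin n → ℝ) :=
  {φ | (∀ i, 0 ≤ φ i) ∧ P.proj φ = b}

/-- `φ` is a critical point of the cubic form along the affine subspace `{ψ | proj ψ = proj φ}`: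
the derivatives at `φ` in all the directions of that subspace vanish. -/
def IsFiberCritical {n : ℕ} (P : HeightOnePolygon n) (φ : Fin n → ℝ) : Prop :=
  ∀ u : Fin n → ℝ, P.proj u = 0 → HasLineDerivAt ℝ P.cubic 0 φ u

/-- `ℓⁱ(b) = ⟨vᵢ₋₁, vᵢ, vᵢ₊₁⟩ / (⟨b, vᵢ₋₁, vᵢ⟩ ⟨b, vᵢ, vᵢ₊₁⟩)`. -/
def ell {n : ℕ} (P : HeightOnePolygon n) (b : Fin 3 → ℝ) (i : Fin n) : ℝ :=
  det3 (P.prev i) (P.vertex i) (P.next i) /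
    (det3 b (P.prev i) (P.vertex i) * det3 b (P.vertex i) (P.next i))

/-- The trial volume function `V(b) = ∑ ℓⁱ(b)`. -/
def trialVolume {n : ℕ} (P : HeightOnePolygon n) (b : Fin 3 → ℝ) : ℝ :=
  ∑ i : Fin n, P.ell b i

/-- The point `σ(b) = (r / V(b)) ℓ(b)` of `ℝⁿ`. -/
def sigma {n : ℕ} (P : HeightOnePolygon n) (r : ℝ) (b : Fin 3 → ℝ) : Fin n → ℝ :=
  fun i => r / P.trialVolume b * P.ell b i

end HeightOnePolygon

/-- The simplex of nonnegative vectors in `ℝⁿ` with coordinate sum `r`. -/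
def simplexOfSum (n : ℕ) (r : ℝ) : Set (Fin n → ℝ) :=
  {φ | (∀ i, 0 ≤ φ i) ∧ ∑ i, φ i = r}

end

open scoped Pointwise

noncomputable section

/-! For fixed b let B_b(φ, ψ) = ∑ sign(j - i) ⟨b, vᵢ, vⱼ⟩ φⁱ ψʲ (`fiberForm`). This form is
symmetric, linear in b, and equals twice the cubic on the diagonal when b = ∑ φᵖ vₚ
(`fiberForm_proj_self`). So on each fiber the cubic is quadratic.

B_b is negative definite on the kernel of the projection. By linearity it suffices to take b = vₚ
(`fiberForm_vertex_neg`). Projection from vₚ puts the other vertices on a line, in increasing order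
of index, and after a rescaling the form has kernel |xᵢ - xⱼ| on vectors of sum zero; there it is
negative definite (`abs_kernel_neg`).

With Eⱼ = (vⱼ₊₁ - vⱼ)/⟨b, vⱼ, vⱼ₊₁⟩ one has r ℓʲ vⱼ = Eⱼ₋₁ - Eⱼ + ℓʲ b (`ell_smul_vertex`).
Summation over the cycle shows that σ lies over b; signed summation shows that B_b(u, σ) depends
only on ∑ uⁱ vᵢ (`fiberForm_sigma`), so σ is critical, with value r/V. Definiteness makes it the
unique critical point and the maximum.

For the simplex, compactness gives a maximizer of positive value. It cannot be supported on one
edge, so it lies over an interior point, and the fiberwise maxima can be compared. -/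

/-! ### Determinants of three vectors -/

lemma det3_eq (u v w : Fin 3 → ℝ) : det3 u v w =
    u 0 * (v 1 * w 2 - v 2 * w 1) - u 1 * (v 0 * w 2 - v 2 * w 0)
      + u 2 * (v 0 * w 1 - v 1 * w 0) := by
  simp [det3, Matrix.det_fin_three]
  ring

lemma det3_rotate (u v w : Fin 3 → ℝ) : det3 u v w = det3 v w u := by
  simp only [det3_eq]; ring

lemma det3_swap (u v w : Fin 3 → ℝ) : det3 u v w = -det3 v u w := by
  simp only [det3_eq]; ring

lemma det3_swap_right (u v w : Fin 3 → ℝ) : det3 u v w = -det3 u w v := by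
  simp only [det3_eq]; ring

lemma det3_self_left (u w : Fin 3 → ℝ) : det3 u u w = 0 := by
  simp only [det3_eq]; ring

lemma det3_self_right (u w : Fin 3 → ℝ) : det3 w u u = 0 := by
  simp only [det3_eq]; ring

/-- The determinant as a linear function of its first column. -/
def det3Linear (v w : Fin 3 → ℝ) : (Fin 3 → ℝ) →ₗ[ℝ] ℝ where
  toFun u := det3 u v w
  map_add' x y := by simp only [det3_eq, Pi.add_apply]; ring
  map_smul' c x := by
    simp only [det3_eq, Pi.smul_apply, smul_eq_mul, RingHom.id_apply]; ring

lemma det3_smul (c : ℝ) (u v w : Fin 3 → ℝ) : det3 (c • u) v w = c * det3 u v w :=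
  (det3Linear v w).map_smul c u

lemma continuous_det3 (v w : Fin 3 → ℝ) : Continuous fun u => det3 u v w :=
  (det3Linear v w).continuous_of_finiteDimensional

/-! ### Conditional negative definiteness of |xᵢ - xⱼ| -/

/-- The sign of `j - i`. -/
def indexSign {n : ℕ} (i j : Fin n) : ℝ := if i < j then 1 else if j < i then -1 else 0

lemma indexSign_swap {n : ℕ} (i j : Fin n) : indexSign i j = -indexSign j i := by
  unfold indexSign
  split_ifs <;> first | (exfalso; omega) | norm_num

/-- The kernel `|xᵢ - xⱼ|` is conditionally negative definite, in a form suited to induction. -/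
lemma abs_kernel_le {n : ℕ} (a x : Fin n → ℝ) (s : Finset (Fin n)) :
    StrictMonoOn x s → ∀ y, (∀ i ∈ s, x i < y) →
      (∑ i ∈ s, ∑ j ∈ s, indexSign i j * (x j - x i) * (a i * a j)
        ≤ 2 * (∑ i ∈ s, a i) * ∑ i ∈ s, a i * (y - x i)) ∧
      (∑ i ∈ s, ∑ j ∈ s, indexSign i j * (x j - x i) * (a i * a j)
        = 2 * (∑ i ∈ s, a i) * ∑ i ∈ s, a i * (y - x i) → ∀ i ∈ s, a i = 0) := by
  induction s using Finset.induction_on_max with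
  | empty => simp
  | insert m s hm ih =>
    intro hx y hy
    have hms : m ∉ s := fun h => lt_irrefl _ (hm m h)
    have hxs : StrictMonoOn x s := hx.mono (by simp)
    have hxm : ∀ i ∈ s, x i < x m := fun i hi =>
      hx (by simp [hi]) (by simp) (hm i hi)
    have hym : x m < y := hy m (by simp)
    obtain ⟨hle, heq⟩ := ih hxs (x m) hxm
    set A := ∑ i ∈ s, a i with hA
    set X := ∑ i ∈ s, a i * (x m - x i) with hX
    set E := ∑ i ∈ s, ∑ j ∈ s, indexSign i j * (x j - x i) * (a i * a j) with hE
    have hX' : ∑ i ∈ insert m s, a i * (y - x i) = X + (A + a m) * (y - x m) := by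
      rw [Finset.sum_insert hms, hX]
      have : ∑ i ∈ s, a i * (y - x i) = ∑ i ∈ s, a i * (x m - x i) + A * (y - x m) := by
        rw [hA, Finset.sum_mul, ← Finset.sum_add_distrib]
        exact Finset.sum_congr rfl fun i _ => by ring
      rw [this]; ring
    have hA' : ∑ i ∈ insert m s, a i = A + a m := by
      rw [Finset.sum_insert hms]; ring
    have h1 : ∑ j ∈ s, indexSign m j * (x j - x m) * (a m * a j) = a m * X := by
      rw [hX, Finset.mul_sum]
      refine Finset.sum_congr rfl fun j hj => ?_
      have : indexSign m j = -1 := by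
        simp [indexSign, hm j hj, (hm j hj).le]
      rw [this]; ring
    have h2 : ∑ i ∈ s, indexSign i m * (x m - x i) * (a i * a m) = a m * X := by
      rw [hX, Finset.mul_sum]
      refine Finset.sum_congr rfl fun j hj => ?_
      have : indexSign j m = 1 := by simp [indexSign, hm j hj]
      rw [this]; ring
    have hE' : ∑ i ∈ insert m s, ∑ j ∈ insert m s, indexSign i j * (x j - x i) * (a i * a j)
        = E + 2 * (a m * X) := by
      simp only [Finset.sum_insert hms, Finset.sum_add_distrib, h1, h2]
      simp only [sub_self, mul_zero, zero_mul]
      ring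
    rw [hE', hA', hX']
    -- The gap between the two sides for `insert m s` is the gap for `s` at the bound `x m`, plus
    -- twice this square term; hence the freedom in `y`.
    have hsq : 0 ≤ (A + a m) ^ 2 * (y - x m) :=
      mul_nonneg (sq_nonneg _) (sub_pos.2 hym).le
    refine ⟨by nlinarith, fun h => ?_⟩
    have hz : (A + a m) ^ 2 * (y - x m) = 0 := by nlinarith
    have hz' : A + a m = 0 := by
      rcases mul_eq_zero.1 hz with h | h
      · exact pow_eq_zero_iff (two_ne_zero) |>.1 h
      · linarith
    have hs : ∀ i ∈ s, a i = 0 := heq (by nlinarith)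
    have hA0 : A = 0 := Finset.sum_eq_zero hs
    intro i hi
    rcases Finset.mem_insert.1 hi with rfl | hi
    · linarith
    · exact hs i hi

lemma abs_kernel_neg {n : ℕ} (a x : Fin n → ℝ) (s : Finset (Fin n)) (hx : StrictMonoOn x s)
    (ha : ∑ i ∈ s, a i = 0) (hne : ∃ i ∈ s, a i ≠ 0) :
    ∑ i ∈ s, ∑ j ∈ s, indexSign i j * (x j - x i) * (a i * a j) < 0 := by
  -- Any strict upper bound will do: the factor `∑ a i = 0` kills the right side.
  have hy : ∀ i ∈ s, x i < 1 + ∑ k ∈ s, |x k| := fun i hi => by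
    have := Finset.single_le_sum (f := fun k => |x k|) (fun k _ => abs_nonneg _) hi
    have := le_abs_self (x i)
    linarith
  obtain ⟨hle, heq⟩ := abs_kernel_le a x s hx _ hy
  rw [ha, mul_zero, zero_mul] at hle heq
  refine lt_of_le_of_ne hle fun h => ?_
  obtain ⟨i, hi, hi'⟩ := hne
  exact hi' (heq h i hi)

/-! ### Plücker relation, cyclic telescoping and the edge identity -/

lemma det3_plucker (p z z' v w : Fin 3 → ℝ) :
    det3 p v z * det3 p w z' - det3 p w z * det3 p v z' = det3 p z z' * det3 p v w := by
  simp only [det3_eq]; ring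

lemma exists_det3_pos (p z v : Fin 3 → ℝ) (h : det3 p v z ≠ 0) : ∃ z', 0 < det3 p z z' := by
  rw [det3_swap_right, ← det3_rotate] at h
  rcases lt_or_gt_of_ne h with h | h
  · exact ⟨v, by rw [det3_rotate, det3_rotate]; linarith⟩
  · exact ⟨-v, by simp only [det3_eq, Pi.neg_apply] at h ⊢; linarith⟩

lemma val_finRotate {n : ℕ} (i : Fin n) :
    (i.val + 1 < n ∧ (finRotate n i).val = i.val + 1) ∨
      (i.val + 1 = n ∧ (finRotate n i).val = 0) := by
  obtain _ | m := n
  · exact i.elim0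
  · rw [coe_finRotate]
    split_ifs with h
    · right; simp [h]
    · left
      refine ⟨?_, rfl⟩
      have := i.isLt
      have : i.val ≠ m := fun h' => h (Fin.ext h')
      omega

/-- Summation by parts: around the cycle the sign jumps by 1 on entering and on leaving `i`, and the
closing step from the last index to 0 contributes the compensating -2. -/
lemma sum_indexSign_telescope {n : ℕ} (hn : 0 < n) (f : Fin n → ℝ) (i : Fin n) :
    ∑ j, indexSign i j * (f ((finRotate n).symm j) - f j) =
      f i + f ((finRotate n).symm i) - 2 * f ((finRotate n).symm ⟨0, hn⟩) := by
  have h1 : ∑ j, indexSign i j * f ((finRotate n).symm j)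
      = ∑ j, indexSign i (finRotate n j) * f j := by
    rw [← Equiv.sum_comp (finRotate n)]
    simp only [Equiv.symm_apply_apply]
  have h2 : ∀ j, indexSign i (finRotate n j) - indexSign i j =
      (if j = i then 1 else 0) + (if j = (finRotate n).symm i then 1 else 0)
        - 2 * (if j = (finRotate n).symm ⟨0, hn⟩ then 1 else 0) := by
    intro j
    simp only [Equiv.eq_symm_apply, indexSign, Fin.lt_def, Fin.ext_iff]
    have := i.isLt
    rcases val_finRotate j with ⟨h, h'⟩ | ⟨h, h'⟩ <;> rw [h'] <;>
      split_ifs <;> first | (exfalso; omega) | norm_num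
  simp only [mul_sub, Finset.sum_sub_distrib]
  rw [h1, ← Finset.sum_sub_distrib]
  simp only [← sub_mul, h2]
  simp only [sub_mul, add_mul, Finset.sum_sub_distrib, Finset.sum_add_distrib, mul_assoc,
    ← Finset.mul_sum, ite_mul, one_mul, zero_mul, Finset.sum_ite_eq', Finset.mem_univ, if_true]

lemma edge_identity (a v c b : Fin 3 → ℝ) (ha : a 2 = 1) (hv : v 2 = 1) (hc : c 2 = 1)
    (h1 : det3 b a v ≠ 0) (h2 : det3 b v c ≠ 0) :
    (b 2 * (det3 a v c / (det3 b a v * det3 b v c))) • v =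
      (det3 b a v)⁻¹ • (v - a) - (det3 b v c)⁻¹ • (c - v)
        + (det3 a v c / (det3 b a v * det3 b v c)) • b := by
  have key : ∀ k, b 2 * det3 a v c * v k =
      det3 b v c * (v k - a k) - det3 b a v * (c k - v k) + det3 a v c * b k := by
    intro k
    simp only [det3_eq, ha, hv, hc]
    fin_cases k <;> simp [ha, hv, hc] <;> ring
  ext k
  have := key k
  simp only [Pi.smul_apply, Pi.add_apply, Pi.sub_apply, smul_eq_mul]
  generalize det3 a v c = D at *
  generalize det3 b a v = d₁ at *
  generalize det3 b v c = d₂ at *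
  field_simp
  linarith

/-! ### Convexity of the polygon -/

namespace HeightOnePolygon

variable {n : ℕ} (P : HeightOnePolygon n)

lemma next_symm (i : Fin n) : P.next ((finRotate n).symm i) = P.vertex i := by
  rw [next, Equiv.apply_symm_apply]

/-- Rotating the columns preserves the determinant, which reduces every position of `j`, and the
closing edge, to increasing triples. -/
lemma det3_edge_pos (i j : Fin n) (h1 : j ≠ i) (h2 : j ≠ finRotate n i) :
    0 < det3 (P.vertex j) (P.vertex i) (P.next i) := by
  have h1' : j.val ≠ i.val := fun h => h1 (Fin.ext h)
  have h2' : j.val ≠ (finRotate n i).val := fun h => h2 (Fin.ext h)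
  have := j.isLt
  unfold next
  rcases val_finRotate i with ⟨h, h'⟩ | ⟨h, h'⟩
  · rcases lt_or_gt_of_ne h1' with hj | hj
    · exact P.det_pos _ _ _ hj (Fin.lt_def.2 (by omega))
    · rw [det3_rotate]
      exact P.det_pos _ _ _ (Fin.lt_def.2 (by omega)) (Fin.lt_def.2 (by omega))
  · rw [← det3_rotate]
    exact P.det_pos _ _ _ (Fin.lt_def.2 (by omega)) (Fin.lt_def.2 (by omega))

lemma det3_edge_nonneg (i j : Fin n) : 0 ≤ det3 (P.vertex j) (P.vertex i) (P.next i) := by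
  by_cases h1 : j = i
  · rw [h1, det3_self_left]
  by_cases h2 : j = finRotate n i
  · rw [h2, det3_rotate, next, det3_self_right]
  exact (P.det3_edge_pos i j h1 h2).le

lemma det3_corner_pos (i : Fin n) : 0 < det3 (P.prev i) (P.vertex i) (P.next i) := by
  have hn := P.three_le
  refine P.det3_edge_pos i _ (fun h => ?_) (fun h => ?_)
  · have h' := congrArg Fin.val ((Equiv.symm_apply_eq _).1 h)
    rcases val_finRotate i with ⟨_, h''⟩ | ⟨_, h''⟩ <;> omega
  · have h' := congrArg Fin.val ((Equiv.symm_apply_eq _).1 h)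
    rcases val_finRotate i with ⟨_, h1⟩ | ⟨_, h1⟩ <;>
    rcases val_finRotate (finRotate n i) with ⟨_, h2⟩ | ⟨_, h2⟩ <;> omega

/-! ### The quadratic form on a fiber -/

/-- The projection `φ ↦ ∑ φⁱ vᵢ` as a linear map. -/
def projLinear : (Fin n → ℝ) →ₗ[ℝ] (Fin 3 → ℝ) := Fintype.linearCombination ℝ P.vertex

lemma projLinear_apply (φ : Fin n → ℝ) : P.projLinear φ = P.proj φ := by
  simp [projLinear, proj, Fintype.linearCombination_apply]

lemma map_proj {M : Type*} [AddCommGroup M] [Module ℝ M] (f : (Fin 3 → ℝ) →ₗ[ℝ] M)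
    (φ : Fin n → ℝ) :
    f (P.proj φ) = ∑ i, φ i • f (P.vertex i) := by
  simp [proj, map_sum]

lemma det3_proj (φ : Fin n → ℝ) (v w : Fin 3 → ℝ) :
    det3 (P.proj φ) v w = ∑ i, φ i * det3 (P.vertex i) v w :=
  P.map_proj (det3Linear v w) φ

lemma proj_height (φ : Fin n → ℝ) : P.proj φ 2 = ∑ i, φ i := by
  simp [proj, P.height_one]

/-- The symmetric bilinear form whose diagonal restricts to twice the cubic form on the fiber
over `b`. -/
def fiberForm (b : Fin 3 → ℝ) (φ ψ : Fin n → ℝ) : ℝ :=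
  ∑ i, ∑ j, indexSign i j * det3 b (P.vertex i) (P.vertex j) * (φ i * ψ j)

lemma fiberForm_comm (b : Fin 3 → ℝ) (φ ψ : Fin n → ℝ) :
    P.fiberForm b φ ψ = P.fiberForm b ψ φ := by
  unfold fiberForm
  rw [Finset.sum_comm]
  refine Finset.sum_congr rfl fun i _ => Finset.sum_congr rfl fun j _ => ?_
  rw [indexSign_swap, det3_swap_right]
  ring

lemma fiberForm_add_smul (b : Fin 3 → ℝ) (φ u : Fin n → ℝ) (t : ℝ) :
    P.fiberForm b (φ + t • u) (φ + t • u) =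
      P.fiberForm b φ φ + 2 * t * P.fiberForm b φ u + t ^ 2 * P.fiberForm b u u := by
  have : P.fiberForm b (φ + t • u) (φ + t • u) =
      P.fiberForm b φ φ + t * P.fiberForm b φ u + t * P.fiberForm b u φ
        + t ^ 2 * P.fiberForm b u u := by
    simp only [fiberForm, Finset.mul_sum, ← Finset.sum_add_distrib]
    refine Finset.sum_congr rfl fun i _ => Finset.sum_congr rfl fun j _ => ?_
    simp only [Pi.add_apply, Pi.smul_apply, smul_eq_mul]
    ring
  rw [this, P.fiberForm_comm b u φ]
  ring

lemma fiberForm_proj (φ u w : Fin n → ℝ) :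
    P.fiberForm (P.proj φ) u w = ∑ p, φ p * P.fiberForm (P.vertex p) u w := by
  simp only [fiberForm, det3_proj, Finset.mul_sum, Finset.sum_mul]
  rw [Finset.sum_comm' (t' := Finset.univ) (s' := fun _ => Finset.univ) (by simp)]
  rw [Finset.sum_congr rfl fun j _ => Finset.sum_comm, Finset.sum_comm]
  refine Finset.sum_congr rfl fun p _ => ?_
  rw [Finset.sum_comm]
  refine Finset.sum_congr rfl fun i _ => Finset.sum_congr rfl fun j _ => ?_
  ring

lemma cubic_eq_sum_ite (φ : Fin n → ℝ) : P.cubic φ = ∑ i, ∑ j, ∑ k,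
    if i < j ∧ j < k then
      det3 (P.vertex i) (P.vertex j) (P.vertex k) * (φ i * φ j * φ k) else 0 := by
  unfold cubic
  refine Finset.sum_congr rfl fun i _ => ?_
  have h1 : Finset.Ioi i = Finset.univ.filter (i < ·) := by ext; simp
  rw [h1, Finset.sum_filter]
  refine Finset.sum_congr rfl fun j _ => ?_
  have h2 : Finset.Ioi j = Finset.univ.filter (j < ·) := by ext; simp
  rw [h2, Finset.sum_filter]
  by_cases hij : i < j
  · rw [if_pos hij]
    refine Finset.sum_congr rfl fun k _ => ?_
    by_cases hjk : j < k
    · rw [if_pos hjk, if_pos ⟨hij, hjk⟩, abs_of_pos (P.det_pos _ _ _ hij hjk)]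
      ring
    · rw [if_neg hjk, if_neg (fun h => hjk h.2)]
  · rw [if_neg hij]
    symm
    exact Finset.sum_eq_zero fun k _ => if_neg fun h => hij h.1

/-- After expanding b, each increasing triple occurs six times: four times with sign + (`p` smallest
or largest) and twice with sign - (`p` in the middle), a net count of 2. -/
lemma fiberForm_proj_self (φ : Fin n → ℝ) :
    P.fiberForm (P.proj φ) φ φ = 2 * P.cubic φ := by
  let g : Fin n → Fin n → Fin n → ℝ := fun i j k =>
    if i < j ∧ j < k then
      det3 (P.vertex i) (P.vertex j) (P.vertex k) * (φ i * φ j * φ k) else 0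
  have hg : P.cubic φ = ∑ i, ∑ j, ∑ k, g i j k := P.cubic_eq_sum_ite φ
  -- For distinct indices exactly one of the six terms survives; if two indices agree, both sides
  -- vanish.
  have key : ∀ p i j, φ p * (indexSign i j * det3 (P.vertex p) (P.vertex i) (P.vertex j) *
      (φ i * φ j)) = (g p i j + g p j i) + (g i j p + g j i p) - (g i p j + g j p i) := by
    intro p i j
    simp only [g]
    by_cases hij : i = j
    · subst hij
      rw [det3_self_right]
      have h1 : ¬ (i < p ∧ p < i) := fun h => lt_asymm h.1 h.2
      simp [h1]
    by_cases hpi : p = i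
    · subst hpi
      rw [det3_self_left]
      have h2 : ¬ (p < j ∧ j < p) := fun h => lt_asymm h.1 h.2
      simp [h2]
    by_cases hpj : p = j
    · subst hpj
      rw [det3_rotate, det3_self_right]
      have h2 : ¬ (p < i ∧ i < p) := fun h => lt_asymm h.1 h.2
      simp [h2]
    have e1 : det3 (P.vertex p) (P.vertex j) (P.vertex i)
        = -det3 (P.vertex p) (P.vertex i) (P.vertex j) := det3_swap_right _ _ _
    have e2 : det3 (P.vertex i) (P.vertex j) (P.vertex p)
        = det3 (P.vertex p) (P.vertex i) (P.vertex j) := (det3_rotate _ _ _).symm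
    have e3 : det3 (P.vertex j) (P.vertex i) (P.vertex p)
        = -det3 (P.vertex p) (P.vertex i) (P.vertex j) := by rw [det3_swap, e2]
    have e4 : det3 (P.vertex i) (P.vertex p) (P.vertex j)
        = -det3 (P.vertex p) (P.vertex i) (P.vertex j) := det3_swap _ _ _
    have e5 : det3 (P.vertex j) (P.vertex p) (P.vertex i)
        = det3 (P.vertex p) (P.vertex i) (P.vertex j) := det3_rotate _ _ _
    simp only [e1, e2, e3, e4, e5, indexSign]
    rcases lt_or_gt_of_ne hij with h1 | h1 <;> rcases lt_or_gt_of_ne hpi with h2 | h2 <;>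
    rcases lt_or_gt_of_ne hpj with h3 | h3 <;>
    simp only [h1, h2, h3, h1.not_gt, h2.not_gt, h3.not_gt, and_true, and_false, if_true,
      if_false, and_self] <;> first | (exfalso; order) | ring
  have swap : ∀ f : Fin n → Fin n → Fin n → ℝ,
      ∑ p, ∑ i, ∑ j, f p j i = ∑ p, ∑ i, ∑ j, f p i j :=
    fun f => Finset.sum_congr rfl fun p _ => Finset.sum_comm
  have swap' : ∀ f : Fin n → Fin n → Fin n → ℝ,
      ∑ p, ∑ i, ∑ j, f i p j = ∑ p, ∑ i, ∑ j, f p i j := fun f => Finset.sum_comm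
  rw [fiberForm_proj]
  simp only [fiberForm, Finset.mul_sum, key, Finset.sum_sub_distrib, Finset.sum_add_distrib]
  have a1 : ∑ p, ∑ i, ∑ j, g p j i = P.cubic φ := by rw [swap g, hg]
  have a2 : ∑ p, ∑ i, ∑ j, g i p j = P.cubic φ := by rw [swap' g, hg]
  have a3 : ∑ p, ∑ i, ∑ j, g i j p = P.cubic φ := by
    rw [swap' (fun p i j => g p j i), a1]
  have a4 : ∑ p, ∑ i, ∑ j, g j i p = P.cubic φ := by
    rw [swap (fun p i j => g i j p), a3]
  have a5 : ∑ p, ∑ i, ∑ j, g j p i = P.cubic φ := by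
    rw [swap (fun p i j => g i p j), a2]
  rw [a1, a2, a3, a4, a5, ← hg]
  ring

lemma exists_quadratic (b : Fin 3 → ℝ) : ∃ Q : MvPolynomial (Fin n) ℝ, Q.IsHomogeneous 2 ∧
    ∀ φ : Fin n → ℝ, P.proj φ = b → P.cubic φ = MvPolynomial.eval φ Q := by
  refine ⟨∑ i, ∑ j, MvPolynomial.C (indexSign i j * det3 b (P.vertex i) (P.vertex j) / 2) *
    (MvPolynomial.X i * MvPolynomial.X j), ?_, ?_⟩
  · refine MvPolynomial.IsHomogeneous.sum _ _ _ fun i _ =>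
      MvPolynomial.IsHomogeneous.sum _ _ _ fun j _ => ?_
    simpa using (MvPolynomial.isHomogeneous_C _ _).mul
      ((MvPolynomial.isHomogeneous_X ℝ i).mul (MvPolynomial.isHomogeneous_X ℝ j))
  · intro φ hφ
    have h := P.fiberForm_proj_self φ
    rw [hφ] at h
    have : P.cubic φ = P.fiberForm b φ φ / 2 := by rw [h]; ring
    rw [this, fiberForm, Finset.sum_div]
    simp only [map_sum, map_mul, MvPolynomial.eval_C, MvPolynomial.eval_X]
    refine Finset.sum_congr rfl fun i _ => ?_
    rw [Finset.sum_div]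
    exact Finset.sum_congr rfl fun j _ => by ring

/-! ### Negative definiteness along the fibers -/

/-- There is a line through the vertex `p` that separates the vertices before `p` from those
after it. -/
lemma exists_separating (p : Fin n) : ∃ z : Fin 3 → ℝ,
    (∀ i, p < i → 0 < det3 (P.vertex p) (P.vertex i) z) ∧
    (∀ i, i < p → det3 (P.vertex p) (P.vertex i) z < 0) := by
  have hn := P.three_le
  have hp := p.isLt
  have hsub : ∀ a b c d : Fin 3 → ℝ, det3 a b (c - d) = det3 a b c - det3 a b d := by
    intro a b c d; simp only [det3_eq, Pi.sub_apply]; ring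
  have hadd : ∀ a b c d : Fin 3 → ℝ, det3 a b (c + d) = det3 a b c + det3 a b d := by
    intro a b c d; simp only [det3_eq, Pi.add_apply]; ring
  have hnn : ∀ i j k, i ≤ j → j ≤ k →
      0 ≤ det3 (P.vertex i) (P.vertex j) (P.vertex k) := by
    intro i j k hij hjk
    rcases hij.eq_or_lt with rfl | hij
    · rw [det3_self_left]
    rcases hjk.eq_or_lt with rfl | hjk
    · rw [det3_self_right]
    exact (P.det_pos _ _ _ hij hjk).le
  let o : Fin n := ⟨0, by omega⟩
  let o' : Fin n := ⟨1, by omega⟩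
  let l : Fin n := ⟨n - 1, by omega⟩
  let l' : Fin n := ⟨n - 2, by omega⟩
  have ho : ∀ i, o ≤ i := fun i => Fin.le_def.2 (Nat.zero_le _)
  have hl : ∀ i, i ≤ l := fun i => Fin.le_def.2 (by have := i.isLt; simp only [l]; omega)
  -- In general the line joins vertex `p` to the midpoint of the closing edge from `l` to `o`. If
  -- `p` is an end of that edge, all other vertices must lie on one side, and the line parallel to
  -- the diagonal between the two neighbours of `p` is used.
  rcases (ho p).eq_or_lt with h0 | h0
  · refine ⟨P.vertex l - P.vertex o', fun i hi => ?_, fun i hi => ?_⟩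
    · rw [hsub, det3_swap_right _ _ (P.vertex o')]
      rcases (hl i).eq_or_lt with h | h
      · have := hnn p i l hi.le (hl i)
        have := P.det_pos p o' i (Fin.lt_def.2 (by simp [← h0, o, o']))
          (Fin.lt_def.2 (by rw [h]; simp only [o', l]; omega))
        linarith
      · have := P.det_pos p i l hi h
        have := hnn p o' i (by rw [← h0]; exact ho _)
          (Fin.le_def.2 (by have := Fin.lt_def.1 hi; simp only [o']; omega))
        linarith
    · exact absurd hi (by rw [← h0]; exact (ho i).not_gt)
  rcases (hl p).eq_or_lt with h1 | h1
  · refine ⟨P.vertex o - P.vertex l', fun i hi => ?_, fun i hi => ?_⟩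
    · exact absurd hi (by rw [h1]; exact (hl i).not_gt)
    · rw [hsub, det3_rotate _ _ (P.vertex l'), det3_swap_right, det3_rotate,
        det3_swap_right (P.vertex i)]
      rcases (ho i).eq_or_lt with h | h
      · have := hnn o i p (ho i) hi.le
        have := P.det_pos i l' p (Fin.lt_def.2 (by rw [← h]; simp only [o, l']; omega))
          (Fin.lt_def.2 (by rw [h1]; simp only [l, l']; omega))
        simp only [det3_eq] at *
        linarith
      · have := P.det_pos o i p h hi
        have := hnn i l' p
          (Fin.le_def.2 (by have := Fin.lt_def.1 hi; rw [h1] at this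
                            simp only [l, l'] at *; omega))
          (Fin.le_def.2 (by rw [h1]; simp only [l, l']; omega))
        simp only [det3_eq] at *
        linarith
  · refine ⟨P.vertex o + P.vertex l, fun i hi => ?_, fun i hi => ?_⟩
    · rw [hadd, ← det3_rotate (P.vertex o)]
      have := P.det_pos o p i h0 hi
      have := hnn p i l hi.le (hl i)
      linarith
    · rw [hadd]
      have := P.det_pos i p l hi h1
      have := hnn o i p (ho i) hi.le
      simp only [det3_eq] at *
      linarith

/-- In the projection from vₚ, vertex `i` has homogeneous coordinates `t i` and `det3 vₚ vᵢ z'`,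
with affine coordinate `x i` their quotient. By the Plücker relation ⟨vₚ, vᵢ, vⱼ⟩ is a positive
multiple of `t i * t j * (x j - x i)`, so the weights `u i * t i` turn the form into the distance
kernel. -/
lemma fiberForm_vertex_neg (p : Fin n) (u : Fin n → ℝ) (hu : P.proj u = 0) (hne : u ≠ 0) :
    P.fiberForm (P.vertex p) u u < 0 := by
  obtain ⟨z, hpos, hneg⟩ := P.exists_separating p
  set t : Fin n → ℝ := fun i => det3 (P.vertex p) (P.vertex i) z with ht
  have ht0 : ∀ i, i ≠ p → t i ≠ 0 := fun i hi => by
    rcases lt_or_gt_of_ne hi with h | h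
    · exact (hneg i h).ne
    · exact (hpos i h).ne'
  have hsum : ∑ i, u i = 0 := by rw [← P.proj_height, hu]; rfl
  have hex : ∃ i, i ≠ p ∧ u i ≠ 0 := by
    by_contra! h
    rw [Finset.sum_eq_single p (fun i _ hi => h i hi) (by simp)] at hsum
    exact hne (funext fun i => if hi : i = p then hi ▸ hsum else h i hi)
  obtain ⟨q, hqp, hq⟩ := hex
  obtain ⟨z', hc⟩ := exists_det3_pos _ _ _ (ht0 q hqp)
  set c := det3 (P.vertex p) z z' with hcdef
  set x : Fin n → ℝ := fun i => det3 (P.vertex p) (P.vertex i) z' / t i with hxdef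
  have hx : ∀ i j, i ≠ p → j ≠ p →
      t i * t j * (x j - x i) = c * det3 (P.vertex p) (P.vertex i) (P.vertex j) := by
    intro i j hi hj
    rw [hcdef, ← det3_plucker (P.vertex p) z z' (P.vertex i) (P.vertex j)]
    have h1 := ht0 i hi
    have h2 := ht0 j hj
    simp only [hxdef]
    change _ = t i * _ - t j * _
    field_simp
  have hmono : StrictMonoOn x (Finset.univ.erase p : Finset (Fin n)) := by
    intro i hi j hj hij
    have hi : i ≠ p := by simpa using hi
    have hj : j ≠ p := by simpa using hj
    have h := hx i j hi hj
    rw [← sub_pos]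
    -- When `p` lies between `i` and `j`, both `t i * t j` and ⟨vₚ, vᵢ, vⱼ⟩ are negative, so `x`
    -- still increases across `p`.
    rcases lt_or_gt_of_ne hi with h1 | h1
    · rcases lt_or_gt_of_ne hj with h2 | h2
      · have hd := P.det_pos _ _ _ hij h2
        rw [← det3_rotate] at hd
        exact (pos_iff_pos_of_mul_pos (h ▸ mul_pos hc hd)).1
          (mul_pos_of_neg_of_neg (hneg i h1) (hneg j h2))
      · have hd := P.det_pos _ _ _ h1 h2
        rw [det3_swap] at hd
        have : 0 < -(t i * t j) * (x j - x i) := by nlinarith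
        exact (pos_iff_pos_of_mul_pos this).1
          (neg_pos.2 (mul_neg_of_neg_of_pos (hneg i h1) (hpos j h2)))
    · have hd := P.det_pos _ _ _ h1 hij
      exact (pos_iff_pos_of_mul_pos (h ▸ mul_pos hc hd)).1
        (mul_pos (hpos i h1) (hpos j (h1.trans hij)))
  have htp : t p = 0 := det3_self_left _ _
  have hA : ∑ i ∈ Finset.univ.erase p, u i * t i = 0 := by
    have h1 : ∑ i, u i * t i = 0 := by
      have h2 := P.det3_proj u z (P.vertex p)
      rw [hu] at h2
      have h3 : det3 0 z (P.vertex p) = 0 := (det3Linear z (P.vertex p)).map_zero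
      rw [h3] at h2
      rw [h2]
      exact Finset.sum_congr rfl fun i _ => by rw [ht]; simp only; rw [det3_rotate]
    rw [← h1]
    refine Finset.sum_subset (Finset.subset_univ _) fun i _ hi => ?_
    have : i = p := by simpa using hi
    rw [this, htp, mul_zero]
  have hmain := abs_kernel_neg (fun i => u i * t i) x _ hmono hA
    ⟨q, by simp [hqp], mul_ne_zero hq (ht0 q hqp)⟩
  have heq : ∑ i ∈ Finset.univ.erase p, ∑ j ∈ Finset.univ.erase p,
      indexSign i j * (x j - x i) * (u i * t i * (u j * t j)) =
      c * P.fiberForm (P.vertex p) u u := by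
    rw [fiberForm, ← Finset.sum_erase Finset.univ (a := p)
      (by exact Finset.sum_eq_zero fun j _ => by rw [det3_self_left]; ring), Finset.mul_sum]
    refine Finset.sum_congr rfl fun i hi => ?_
    rw [← Finset.sum_erase Finset.univ (a := p)
      (by rw [det3_rotate, det3_self_right]; ring), Finset.mul_sum]
    refine Finset.sum_congr rfl fun j hj => ?_
    have := hx i j (Finset.ne_of_mem_erase hi) (Finset.ne_of_mem_erase hj)
    linear_combination (indexSign i j * u i * u j) * this
  rw [heq] at hmain
  exact (pos_iff_neg_of_mul_neg hmain).1 hc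

lemma fiberForm_proj_neg (φ u : Fin n → ℝ) (hφ : ∀ i, 0 ≤ φ i) (hφ0 : φ ≠ 0)
    (hu : P.proj u = 0) (hne : u ≠ 0) : P.fiberForm (P.proj φ) u u < 0 := by
  rw [fiberForm_proj]
  obtain ⟨p, hp⟩ := Function.ne_iff.1 hφ0
  exact Finset.sum_neg'
    (fun i _ => mul_nonpos_of_nonneg_of_nonpos (hφ i) (P.fiberForm_vertex_neg i u hu hne).le)
    ⟨p, Finset.mem_univ _, mul_neg_of_pos_of_neg ((hφ p).lt_of_ne' hp)
      (P.fiberForm_vertex_neg p u hu hne)⟩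

/-! ### The critical point over an interior point -/

section Interior

variable {r : ℝ} {b : Fin 3 → ℝ}

/-- The edge vector `(vⱼ₊₁ - vⱼ) / ⟨b, vⱼ, vⱼ₊₁⟩`. -/
def scaledEdge (b : Fin 3 → ℝ) (j : Fin n) : Fin 3 → ℝ :=
  (det3 b (P.vertex j) (P.next j))⁻¹ • (P.next j - P.vertex j)

lemma det3_prev_pos (hd : ∀ i, 0 < det3 b (P.vertex i) (P.next i)) (i : Fin n) :
    0 < det3 b (P.prev i) (P.vertex i) := by
  have h := hd ((finRotate n).symm i)
  rwa [next_symm] at h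

lemma ell_pos (hd : ∀ i, 0 < det3 b (P.vertex i) (P.next i)) (i : Fin n) :
    0 < P.ell b i :=
  div_pos (P.det3_corner_pos i) (mul_pos (P.det3_prev_pos hd i) (hd i))

lemma trialVolume_pos (hd : ∀ i, 0 < det3 b (P.vertex i) (P.next i)) :
    0 < P.trialVolume b := by
  have hn := P.three_le
  exact Finset.sum_pos (fun i _ => P.ell_pos hd i) ⟨⟨0, by omega⟩, Finset.mem_univ _⟩

lemma sigma_pos (hr : 0 < r) (hd : ∀ i, 0 < det3 b (P.vertex i) (P.next i)) (i : Fin n) :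
    0 < P.sigma r b i :=
  mul_pos (div_pos hr (P.trialVolume_pos hd)) (P.ell_pos hd i)

lemma ell_smul_vertex (hb : b 2 = r) (hd : ∀ i, 0 < det3 b (P.vertex i) (P.next i))
    (j : Fin n) : (r * P.ell b j) • P.vertex j =
      P.scaledEdge b ((finRotate n).symm j) - P.scaledEdge b j + P.ell b j • b := by
  have h := edge_identity (P.prev j) (P.vertex j) (P.next j) b (P.height_one _) (P.height_one _)
    (P.height_one _) (P.det3_prev_pos hd j).ne' (hd j).ne'
  rw [hb] at h
  rw [scaledEdge, scaledEdge, next_symm]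
  exact h

lemma smul_proj_ell (hb : b 2 = r) (hd : ∀ i, 0 < det3 b (P.vertex i) (P.next i)) :
    r • P.proj (P.ell b) = P.trialVolume b • b := by
  rw [proj, Finset.smul_sum]
  simp only [smul_smul, P.ell_smul_vertex hb hd, Finset.sum_add_distrib, Finset.sum_sub_distrib]
  rw [Equiv.sum_comp (finRotate n).symm (P.scaledEdge b), sub_self, zero_add, trialVolume,
    Finset.sum_smul]

lemma sigma_eq_smul : P.sigma r b = (r / P.trialVolume b) • P.ell b := rfl

lemma proj_sigma (hb : b 2 = r) (hd : ∀ i, 0 < det3 b (P.vertex i) (P.next i)) :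
    P.proj (P.sigma r b) = b := by
  have hV := P.trialVolume_pos hd
  rw [sigma_eq_smul, ← projLinear_apply, map_smul, projLinear_apply, div_eq_inv_mul, mul_smul,
    P.smul_proj_ell hb hd, smul_smul, inv_mul_cancel₀ hV.ne', one_smul]

lemma sum_indexSign_ell (hb : b 2 = r) (hd : ∀ i, 0 < det3 b (P.vertex i) (P.next i))
    (hn : 0 < n) (i : Fin n) :
    r * ∑ j, indexSign i j * det3 b (P.vertex i) (P.vertex j) * P.ell b j =
      2 * (1 - det3 (P.vertex i) (P.scaledEdge b ((finRotate n).symm ⟨0, hn⟩)) b) := by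
  let L := det3Linear b (P.vertex i)
  have hL : ∀ w, L w = det3 b (P.vertex i) w := fun w => det3_rotate _ _ _
  have hLb : L b = 0 := det3_self_left _ _
  have h1 : L (P.scaledEdge b i) = 1 := by
    rw [scaledEdge, map_smul, map_sub, hL, hL, det3_self_right, sub_zero, smul_eq_mul]
    exact inv_mul_cancel₀ (hd i).ne'
  have h2 : L (P.scaledEdge b ((finRotate n).symm i)) = 1 := by
    rw [scaledEdge, next_symm, map_smul, map_sub, hL, hL, det3_self_right, zero_sub,
      ← det3_swap_right, smul_eq_mul]
    exact inv_mul_cancel₀ (P.det3_prev_pos hd i).ne'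
  have key : ∀ j, r * (indexSign i j * det3 b (P.vertex i) (P.vertex j) * P.ell b j) =
      indexSign i j * (L (P.scaledEdge b ((finRotate n).symm j)) - L (P.scaledEdge b j)) := by
    intro j
    have h := congrArg L (P.ell_smul_vertex hb hd j)
    rw [map_add, map_sub, map_smul, map_smul, hLb, hL (P.vertex j)] at h
    simp only [smul_eq_mul, mul_zero, add_zero] at h
    rw [← h]; ring
  rw [Finset.mul_sum, Finset.sum_congr rfl fun j _ => key j,
    sum_indexSign_telescope hn (fun j => L (P.scaledEdge b j)) i, h1, h2, hL,
    det3_rotate b]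
  ring

/-- The right side sees `u` only through its projection (the sum is the height of `proj u`). It
therefore vanishes on the kernel, and for `u = σ` the determinant has a repeated column b. -/
lemma fiberForm_sigma (hb : b 2 = r)
    (hd : ∀ i, 0 < det3 b (P.vertex i) (P.next i)) (u : Fin n → ℝ) :
    ∃ e, P.fiberForm b u (P.sigma r b) =
      2 / P.trialVolume b * (∑ i, u i - det3 (P.proj u) e b) := by
  have hn := P.three_le
  refine ⟨P.scaledEdge b ((finRotate n).symm ⟨0, by omega⟩), ?_⟩
  have hV := P.trialVolume_pos hd
  rw [det3_proj, ← Finset.sum_sub_distrib, fiberForm, Finset.mul_sum]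
  refine Finset.sum_congr rfl fun i _ => ?_
  have h := P.sum_indexSign_ell hb hd (by omega) i
  calc _ = u i / P.trialVolume b *
        (r * ∑ j, indexSign i j * det3 b (P.vertex i) (P.vertex j) * P.ell b j) := by
        rw [Finset.mul_sum, Finset.mul_sum]
        refine Finset.sum_congr rfl fun j _ => ?_
        rw [sigma]; ring
    _ = _ := by rw [h]; ring

lemma cubic_sigma (hb : b 2 = r)
    (hd : ∀ i, 0 < det3 b (P.vertex i) (P.next i)) :
    P.cubic (P.sigma r b) = r / P.trialVolume b := by
  obtain ⟨e, he⟩ := P.fiberForm_sigma hb hd (P.sigma r b)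
  have h := P.fiberForm_proj_self (P.sigma r b)
  rw [← proj_height, P.proj_sigma hb hd, hb, det3_rotate, det3_self_right, sub_zero] at he
  rw [P.proj_sigma hb hd, he] at h
  have : P.cubic (P.sigma r b) = 2 / P.trialVolume b * r / 2 := by rw [h]; ring
  rw [this]; ring

lemma fiberForm_sigma_eq_zero (hb : b 2 = r)
    (hd : ∀ i, 0 < det3 b (P.vertex i) (P.next i)) (u : Fin n → ℝ) (hu : P.proj u = 0) :
    P.fiberForm b (P.sigma r b) u = 0 := by
  obtain ⟨e, he⟩ := P.fiberForm_sigma hb hd u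
  have h0 : det3 0 e b = 0 := (det3Linear e b).map_zero
  rw [fiberForm_comm, he, ← proj_height, hu, h0]
  simp

lemma fiberForm_neg (hr : 0 < r) (hb : b 2 = r)
    (hd : ∀ i, 0 < det3 b (P.vertex i) (P.next i)) (u : Fin n → ℝ) (hu : P.proj u = 0)
    (hne : u ≠ 0) : P.fiberForm b u u < 0 := by
  have hn := P.three_le
  have h := P.fiberForm_proj_neg (P.sigma r b) u (fun i => (P.sigma_pos hr hd i).le)
    (fun h => (P.sigma_pos hr hd ⟨0, by omega⟩).ne' (congrFun h _)) hu hne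
  rwa [P.proj_sigma hb hd] at h

/-! ### Uniqueness and maximality of the critical point -/

lemma cubic_add_smul (φ u : Fin n → ℝ) (hu : P.proj u = 0) (t : ℝ) :
    P.cubic (φ + t • u) = P.cubic φ + t * P.fiberForm (P.proj φ) φ u
      + t ^ 2 * (P.fiberForm (P.proj φ) u u / 2) := by
  have hp : P.proj (φ + t • u) = P.proj φ := by
    rw [← projLinear_apply, map_add, map_smul, projLinear_apply, projLinear_apply, hu]
    simp
  have h1 := P.fiberForm_proj_self (φ + t • u)
  have h2 := P.fiberForm_proj_self φ
  rw [hp, fiberForm_add_smul] at h1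
  linarith

lemma isFiberCritical_iff (φ : Fin n → ℝ) :
    P.IsFiberCritical φ ↔ ∀ u, P.proj u = 0 → P.fiberForm (P.proj φ) φ u = 0 := by
  refine forall₂_congr fun u hu => ?_
  have hder : HasLineDerivAt ℝ P.cubic (P.fiberForm (P.proj φ) φ u) φ u := by
    unfold HasLineDerivAt
    simp only [P.cubic_add_smul φ u hu]
    have h1 := ((hasDerivAt_id (0 : ℝ)).mul_const (P.fiberForm (P.proj φ) φ u)).const_add
      (P.cubic φ)
    have h2 := ((hasDerivAt_id (0 : ℝ)).pow 2).mul_const (P.fiberForm (P.proj φ) u u / 2)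
    have h3 := h1.add h2
    simp only [id, one_mul, Pi.add_def] at h3
    simpa using h3
  exact ⟨fun h => hder.unique h, fun h => h ▸ hder⟩

lemma isFiberCritical_iff_eq_sigma (hr : 0 < r) (hb : b 2 = r)
    (hd : ∀ i, 0 < det3 b (P.vertex i) (P.next i)) (φ : Fin n → ℝ) (hφ : P.proj φ = b) :
    P.IsFiberCritical φ ↔ φ = P.sigma r b := by
  rw [isFiberCritical_iff, hφ]
  constructor
  · intro h
    by_contra hne
    have hu : P.proj (P.sigma r b - φ) = 0 := by
      rw [← projLinear_apply, map_sub, projLinear_apply, projLinear_apply, hφ,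
        P.proj_sigma hb hd, sub_self]
    have h1 := P.fiberForm_neg hr hb hd _ hu (sub_ne_zero.2 (Ne.symm hne))
    -- Expanding from either critical point gives B(σ, σ) - B(φ, φ) = B(u, u) and its negative, for
    -- u = σ - φ, so B(u, u) = 0.
    have h2 := P.fiberForm_add_smul b φ (P.sigma r b - φ) 1
    have h3 := P.fiberForm_add_smul b (P.sigma r b) (P.sigma r b - φ) (-1)
    rw [P.fiberForm_sigma_eq_zero hb hd _ hu] at h3
    rw [h _ hu] at h2
    have e2 : φ + (1 : ℝ) • (P.sigma r b - φ) = P.sigma r b := by simp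
    have e3 : P.sigma r b + (-1 : ℝ) • (P.sigma r b - φ) = φ := by simp
    rw [e2] at h2
    rw [e3] at h3
    linarith
  · rintro rfl u hu
    exact P.fiberForm_sigma_eq_zero hb hd u hu

lemma cubic_le_cubic_sigma (hr : 0 < r) (hb : b 2 = r)
    (hd : ∀ i, 0 < det3 b (P.vertex i) (P.next i)) (φ : Fin n → ℝ) (hφ : P.proj φ = b) :
    P.cubic φ ≤ P.cubic (P.sigma r b) := by
  have hu : P.proj (φ - P.sigma r b) = 0 := by
    rw [← projLinear_apply, map_sub, projLinear_apply, projLinear_apply, hφ,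
      P.proj_sigma hb hd, sub_self]
  have h := P.cubic_add_smul (P.sigma r b) _ hu 1
  rw [P.proj_sigma hb hd, P.fiberForm_sigma_eq_zero hb hd _ hu, one_smul,
    add_sub_cancel] at h
  have : P.fiberForm b (φ - P.sigma r b) (φ - P.sigma r b) ≤ 0 := by
    by_cases h0 : φ - P.sigma r b = 0
    · rw [h0]; simp [fiberForm]
    · exact (P.fiberForm_neg hr hb hd _ hu h0).le
  linarith

/-! ### The relative interior of the scaled polygon -/

lemma mem_smul_toSet {φ : Fin n → ℝ} (hr : 0 < r) (hφ : ∀ i, 0 ≤ φ i) (hs : ∑ i, φ i = r) :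
    P.proj φ ∈ r • P.toSet := by
  refine Set.mem_smul_set.2 ⟨∑ i, (φ i / r) • P.vertex i, ?_, ?_⟩
  · exact (convex_convexHull ℝ _).sum_mem (fun i _ => div_nonneg (hφ i) hr.le)
      (by rw [← Finset.sum_div, hs, div_self hr.ne'])
      (fun i _ => subset_convexHull ℝ _ (Set.mem_range_self i))
  · rw [Finset.smul_sum, proj]
    refine Finset.sum_congr rfl fun i _ => ?_
    rw [smul_smul, mul_div_cancel₀ _ hr.ne']

lemma toSet_subset {f : (Fin 3 → ℝ) →ₗ[ℝ] ℝ} {c : ℝ} (h : ∀ i, c ≤ f (P.vertex i)) :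
    ∀ x ∈ P.toSet, c ≤ f x := by
  intro x hx
  have : convexHull ℝ (Set.range P.vertex) ⊆ {w | c ≤ f w} :=
    convexHull_min (by rintro _ ⟨i, rfl⟩; exact h i) (convex_halfSpace_ge f.isLinear c)
  exact this hx

lemma height_of_mem (hx : b ∈ r • P.toSet) : b 2 = r := by
  obtain ⟨y, hy, rfl⟩ := Set.mem_smul_set.1 hx
  have h1 := P.toSet_subset (f := LinearMap.proj 2) (c := 1)
    (fun i => (P.height_one i).ge) y hy
  have h2 := P.toSet_subset (f := -LinearMap.proj 2) (c := -1)
    (fun i => by simp [P.height_one i]) y hy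
  simp only [LinearMap.neg_apply, LinearMap.proj_apply] at h1 h2
  have : y 2 = 1 := by linarith
  simp [this]

lemma det3_nonneg_of_mem (hr : 0 < r) (hx : b ∈ r • P.toSet) (i : Fin n) :
    0 ≤ det3 b (P.vertex i) (P.next i) := by
  obtain ⟨y, hy, rfl⟩ := Set.mem_smul_set.1 hx
  rw [det3_smul]
  exact mul_nonneg hr.le (P.toSet_subset (f := det3Linear (P.vertex i) (P.next i))
    (fun j => P.det3_edge_nonneg i j) y hy)

lemma mem_intrinsicInterior_iff (hr : 0 < r) :
    b ∈ intrinsicInterior ℝ (r • P.toSet) ↔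
      b 2 = r ∧ ∀ i, 0 < det3 b (P.vertex i) (P.next i) := by
  have hspan : ∀ x ∈ affineSpan ℝ (r • P.toSet), x 2 = r := by
    intro x hx
    have hle : affineSpan ℝ (r • P.toSet) ≤
        (AffineSubspace.mk' (fun _ => r) (LinearMap.ker
          (LinearMap.proj 2 : (Fin 3 → ℝ) →ₗ[ℝ] ℝ))) := by
      rw [affineSpan_le]
      intro y hy
      simp [AffineSubspace.mem_mk', P.height_of_mem hy]
    have := hle hx
    rw [AffineSubspace.mem_mk'] at this
    simpa [sub_eq_zero] using this
  constructor
  · intro h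
    have hb := intrinsicInterior_subset h
    refine ⟨P.height_of_mem hb, fun i => ?_⟩
    have hn := P.three_le
    obtain ⟨k, hk1, hk2⟩ : ∃ k : Fin n, k ≠ i ∧ k ≠ finRotate n i := by
      have : ({i, finRotate n i} : Finset (Fin n)).card < Fintype.card (Fin n) :=
        lt_of_le_of_lt Finset.card_le_two (by rw [Fintype.card_fin]; omega)
      obtain ⟨k, -, hk⟩ := Finset.exists_mem_notMem_of_card_lt_card this
      rw [Finset.mem_insert, Finset.mem_singleton, not_or] at hk
      exact ⟨k, hk⟩
    have hkpos := P.det3_edge_pos i k hk1 hk2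
    set c := r • P.vertex k with hc
    have hcm : c ∈ r • P.toSet :=
      Set.smul_mem_smul_set (subset_convexHull ℝ _ (Set.mem_range_self k))
    obtain ⟨y, hy, rfl⟩ := mem_intrinsicInterior.1 h
    -- The segment from `c` to `y` is prolonged slightly past `y`. It stays in the polygon, but a
    -- nonpositive determinant at `y` would become negative, as `c` lies strictly inside the edge's
    -- half-plane.
    have hline : ∀ ε : ℝ, AffineMap.lineMap (y : Fin 3 → ℝ) c (-ε) ∈
        affineSpan ℝ (r • P.toSet) := fun ε =>
      AffineMap.lineMap_mem _ y.2 (subset_affineSpan ℝ _ hcm)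
    let g : ℝ → affineSpan ℝ (r • P.toSet) := fun ε => ⟨_, hline ε⟩
    have hg : Continuous g := by
      refine Continuous.subtype_mk ?_ _
      simp only [AffineMap.lineMap_apply_module]
      fun_prop
    have hg0 : g 0 = y := by
      ext1; simp [g]
    have hev : ∀ᶠ ε in nhds (0 : ℝ), (g ε : Fin 3 → ℝ) ∈ r • P.toSet := by
      have : g ⁻¹' interior ((↑) ⁻¹' (r • P.toSet)) ∈ nhds (0 : ℝ) :=
        (isOpen_interior.preimage hg).mem_nhds (by simpa [hg0] using hy)
      filter_upwards [this] with ε hε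
      exact interior_subset (s := ((↑) ⁻¹' (r • P.toSet) :
        Set (affineSpan ℝ (r • P.toSet)))) hε
    obtain ⟨ε, hε, hε0⟩ := (hev.filter_mono nhdsWithin_le_nhds |>.and
      (self_mem_nhdsWithin (s := Set.Ioi (0 : ℝ)))).exists
    have hε0 : 0 < ε := hε0
    have h1 := P.det3_nonneg_of_mem hr hε i
    have h2 : det3 (g ε : Fin 3 → ℝ) (P.vertex i) (P.next i) =
        (1 + ε) * det3 y (P.vertex i) (P.next i) -
          ε * (r * det3 (P.vertex k) (P.vertex i) (P.next i)) := by
      rw [← det3_smul r, ← hc]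
      simp only [g, AffineMap.lineMap_apply_module, det3_eq, Pi.add_apply, Pi.smul_apply,
        smul_eq_mul]
      ring
    have h3 : 0 < ε * (r * det3 (P.vertex k) (P.vertex i) (P.next i)) := by positivity
    by_contra! h4
    nlinarith
  · rintro ⟨hb, hd⟩
    -- `σ` is an explicit positive preimage of `x`, so the edge inequalities already imply
    -- membership.
    have hmem : ∀ x : Fin 3 → ℝ, x 2 = r →
        (∀ i, 0 < det3 x (P.vertex i) (P.next i)) → x ∈ r • P.toSet := by
      intro x hx hdx
      have := P.mem_smul_toSet hr (fun i => (P.sigma_pos hr hdx i).le)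
        (by rw [← P.proj_height, P.proj_sigma hx hdx, hx])
      rwa [P.proj_sigma hx hdx] at this
    rw [mem_intrinsicInterior]
    refine ⟨⟨b, subset_affineSpan ℝ _ (hmem b hb hd)⟩, ?_, rfl⟩
    refine mem_interior.2 ⟨{x | ∀ i, 0 < det3 (x : Fin 3 → ℝ) (P.vertex i) (P.next i)},
      fun x hx => hmem x (hspan x x.2) hx, ?_, hd⟩
    simp only [Set.ofPred_forall]
    exact isOpen_iInter_of_finite fun i => isOpen_lt continuous_const
      ((continuous_det3 _ _).comp continuous_subtype_val)

end Interior

/-! ### Maximization over the simplex -/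

lemma continuous_cubic : Continuous P.cubic := by
  unfold cubic
  fun_prop

lemma cubic_pos {φ : Fin n → ℝ} (hφ : ∀ i, 0 < φ i) : 0 < P.cubic φ := by
  have hn := P.three_le
  have hnn : ∀ i j k, 0 ≤ |det3 (P.vertex i) (P.vertex j) (P.vertex k)| * φ i * φ j * φ k :=
    fun i j k => by have := hφ i; have := hφ j; have := hφ k; positivity
  unfold cubic
  refine Finset.sum_pos' (fun i _ => Finset.sum_nonneg fun j _ => Finset.sum_nonneg
    fun k _ => hnn i j k) ⟨⟨0, by omega⟩, Finset.mem_univ _, ?_⟩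
  refine Finset.sum_pos' (fun j _ => Finset.sum_nonneg fun k _ => hnn _ j k)
    ⟨⟨1, by omega⟩, by simp, ?_⟩
  refine Finset.sum_pos' (fun k _ => hnn _ _ k) ⟨⟨2, by omega⟩, by simp, ?_⟩
  have h1 := P.det_pos ⟨0, by omega⟩ ⟨1, by omega⟩ ⟨2, by omega⟩ (by simp) (by simp)
  exact mul_pos (mul_pos (mul_pos (abs_pos.2 h1.ne') (hφ _)) (hφ _)) (hφ _)

/-- A nonnegative vector with positive cubic form projects into the interior. -/
lemma det3_proj_pos_of_cubic_ne_zero {φ : Fin n → ℝ} (hφ : ∀ i, 0 ≤ φ i)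
    (hc : P.cubic φ ≠ 0) (i : Fin n) : 0 < det3 (P.proj φ) (P.vertex i) (P.next i) := by
  have hnn : ∀ j ∈ Finset.univ, 0 ≤ φ j * det3 (P.vertex j) (P.vertex i) (P.next i) :=
    fun j _ => mul_nonneg (hφ j) (P.det3_edge_nonneg i j)
  rw [det3_proj]
  refine lt_of_le_of_ne (Finset.sum_nonneg hnn) fun h => hc ?_
  have h0 := (Finset.sum_eq_zero_iff_of_nonneg hnn).1 h.symm
  have hz : ∀ j, j ≠ i → j ≠ finRotate n i → φ j = 0 := fun j h1 h2 =>
    (mul_eq_zero.1 (h0 j (Finset.mem_univ _))).resolve_right (P.det3_edge_pos i j h1 h2).ne'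
  unfold cubic
  refine Finset.sum_eq_zero fun p _ => Finset.sum_eq_zero fun q hq =>
    Finset.sum_eq_zero fun s hs => ?_
  have hpq : p < q := by simpa using hq
  have hqs : q < s := by simpa using hs
  -- The support of `φ` lies in the two ends of one edge, which cannot contain three distinct
  -- indices.
  have : φ p = 0 ∨ φ q = 0 ∨ φ s = 0 := by
    by_contra! h
    have e : ∀ j, φ j ≠ 0 → j = i ∨ j = finRotate n i := fun j hj => by
      by_contra! h'
      exact hj (hz j h'.1 h'.2)
    rcases e p h.1 with hp | hp <;> rcases e q h.2.1 with hq | hq <;>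
      rcases e s h.2.2 with hs | hs <;> omega
  rcases this with h | h | h <;> simp [h]

lemma isCompact_simplexOfSum (n : ℕ) (r : ℝ) : IsCompact (simplexOfSum n r) := by
  have hcl : IsClosed (simplexOfSum n r) := by
    have : simplexOfSum n r = (⋂ i, {φ | 0 ≤ φ i}) ∩ {φ | ∑ i, φ i = r} := by
      ext; simp [simplexOfSum]
    rw [this]
    exact (isClosed_iInter fun i => isClosed_le continuous_const (continuous_apply i)).inter
      (isClosed_eq (by fun_prop) continuous_const)
  refine (isCompact_Icc (a := (0 : Fin n → ℝ)) (b := fun _ => r)).of_isClosed_subset hcl ?_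
  rintro φ ⟨h1, h2⟩
  exact ⟨h1, fun i => h2 ▸ Finset.single_le_sum (fun j _ => h1 j) (Finset.mem_univ i)⟩

lemma exists_max_simplex {r : ℝ} (hr : 0 < r) : ∃ φ ∈ simplexOfSum n r,
    IsMaxOn P.cubic (simplexOfSum n r) φ ∧ 0 < P.cubic φ := by
  have hn : (0 : ℝ) < n := by have := P.three_le; exact_mod_cast (by omega : 0 < n)
  have hmem : (fun _ => r / n : Fin n → ℝ) ∈ simplexOfSum n r := by
    refine ⟨fun i => by positivity, ?_⟩
    simp only [Finset.sum_const, Finset.card_univ, Fintype.card_fin, nsmul_eq_mul]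
    field_simp
  obtain ⟨φ, hφ, hmax⟩ := (isCompact_simplexOfSum n r).exists_isMaxOn ⟨_, hmem⟩
    P.continuous_cubic.continuousOn
  exact ⟨φ, hφ, hmax, lt_of_lt_of_le (P.cubic_pos fun i => by positivity) (hmax hmem)⟩

end HeightOnePolygon

end

theorem mainTheorem8 {n : ℕ} (P : HeightOnePolygon n) (r : ℝ) (hr : 0 < r) :
    -- the restriction to each fiber (indeed to the affine subspace containing it) is quadratic
    (∀ b ∈ r • P.toSet, ∃ Q : MvPolynomial (Fin n) ℝ, Q.IsHomogeneous 2 ∧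
      ∀ φ : Fin n → ℝ, P.proj φ = b → P.cubic φ = MvPolynomial.eval φ Q) ∧
    -- fiberwise critical point and maximum
    (∀ b ∈ intrinsicInterior ℝ (r • P.toSet),
      (∀ i, 0 < det3 b (P.vertex i) (P.next i)) ∧
      0 < P.trialVolume b ∧
      P.sigma r b ∈ P.fiber b ∧
      (∀ φ : Fin n → ℝ, P.proj φ = b → (P.IsFiberCritical φ ↔ φ = P.sigma r b)) ∧
      IsMaxOn P.cubic (P.fiber b) (P.sigma r b) ∧
      P.cubic (P.sigma r b) = r / P.trialVolume b ∧
      IsGreatest (P.cubic '' P.fiber b) (r / P.trialVolume b)) ∧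
    -- maximization over the simplex is equivalent to minimization of the trial volume
    (∃ m : ℝ, IsLeast (P.trialVolume '' intrinsicInterior ℝ (r • P.toSet)) m ∧
      IsGreatest (P.cubic '' simplexOfSum n r) (r / m)) := by
  refine ⟨fun b _ => P.exists_quadratic b, fun b hb => ?_, ?_⟩
  · obtain ⟨hb2, hd⟩ := (P.mem_intrinsicInterior_iff hr).1 hb
    have hmem : P.sigma r b ∈ P.fiber b :=
      ⟨fun i => (P.sigma_pos hr hd i).le, P.proj_sigma hb2 hd⟩
    have hmax : IsMaxOn P.cubic (P.fiber b) (P.sigma r b) := fun φ hφ =>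
      P.cubic_le_cubic_sigma hr hb2 hd φ hφ.2
    have hval := P.cubic_sigma hb2 hd
    refine ⟨hd, P.trialVolume_pos hd, hmem, P.isFiberCritical_iff_eq_sigma hr hb2 hd, hmax,
      hval, ⟨_, hmem, hval⟩, ?_⟩
    rintro _ ⟨φ, hφ, rfl⟩
    exact hval ▸ hmax hφ
  · obtain ⟨φ, hφ, hmax, hpos⟩ := P.exists_max_simplex hr
    have hb2 : P.proj φ 2 = r := by rw [P.proj_height, hφ.2]
    have hd := P.det3_proj_pos_of_cubic_ne_zero hφ.1 hpos.ne'
    have hsigma : ∀ b, b 2 = r → (∀ i, 0 < det3 b (P.vertex i) (P.next i)) →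
        r / P.trialVolume b ≤ P.cubic φ := fun b h1 h2 => by
      rw [← P.cubic_sigma h1 h2]
      exact hmax ⟨fun i => (P.sigma_pos hr h2 i).le,
        by rw [← P.proj_height, P.proj_sigma h1 h2, h1]⟩
    -- The global maximizer is bounded by the maximum of its own fiber, which is attained at a point
    -- of the simplex.
    have hval : P.cubic φ = r / P.trialVolume (P.proj φ) :=
      le_antisymm (P.cubic_sigma hb2 hd ▸ P.cubic_le_cubic_sigma hr hb2 hd φ rfl)
        (hsigma _ hb2 hd)
    refine ⟨P.trialVolume (P.proj φ),
      ⟨⟨_, (P.mem_intrinsicInterior_iff hr).2 ⟨hb2, hd⟩, rfl⟩, ?_⟩, ⟨φ, hφ, hval⟩, ?_⟩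
    · rintro _ ⟨b, hb, rfl⟩
      obtain ⟨h1, h2⟩ := (P.mem_intrinsicInterior_iff hr).1 hb
      have h := hsigma b h1 h2
      rw [hval] at h
      exact (div_le_div_iff_of_pos_left hr (P.trialVolume_pos h2) (P.trialVolume_pos hd)).1 h
    · rintro _ ⟨ψ, hψ, rfl⟩
      exact hval ▸ hmax hψ
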